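/- All Banach spaces are real. A metric space $X$ Lipschitz embeds into a metric space $Y$ if there are a (not necessarily linear) map $f:X\to Y$ and a constant $K>0$ with $\frac1K\,d(x,y)\le d(f(x),f(y))\le K\,d(x,y)$ for all $x,y\in X$. A Banach space $X$ embeds linearly into a Banach space $Y$ if there are a bounded linear operator $T:X\to Y$ and a constant $c>0$ with $\|Tx\|\ge c\|x\|$ for all $x\in X$. Write $Z^*$ for the Banach space of bounded linear functionals on $Z$, and $L_q=L_q[0,1]$ with respect to Lebesgue measure. Let $X$ be a separable Banach space. 1. If $F$ is a Banach space and $X$ Lipschitz embeds into the dual space $F^*$, then $X$ embeds linearly into $F^*$. 2. In particular, if $X$ Lipschitz embeds into a Banach space $Y$, then $X$ embeds linearly into $Y^{**}$. 3. Consequently, for every $2<q\le\infty$, the space $L_q$ does not Lipschitz embed into $L_1$. -/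

import Mathlib

open MeasureTheory
open scoped NNReal ENNReal

/-- `X` Lipschitz embeds into `Y`: there is a map `f : X → Y`, not assumed to be linear, which is
Lipschitz and satisfies a lower estimate `dist x y ≤ L * dist (f x) (f y)` for all `x` and `y`. -/
def LipschitzEmbeds (X Y : Type*) [MetricSpace X] [MetricSpace Y] : Prop :=
  ∃ f : X → Y, (∃ K : ℝ≥0, LipschitzWith K f) ∧ ∃ L : ℝ≥0, AntilipschitzWith L f

/-- `X` embeds linearly into `Y`: there is a bounded linear map `T : X → Y` which is an isomorphism
onto its image, that is, `c * ‖x‖ ≤ ‖T x‖` for all `x`, for some constant `c > 0`. -/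
def LinearlyEmbeds (X Y : Type*) [NormedAddCommGroup X] [NormedSpace ℝ X]
    [NormedAddCommGroup Y] [NormedSpace ℝ Y] : Prop :=
  ∃ T : X →L[ℝ] Y, ∃ c : ℝ, 0 < c ∧ ∀ x : X, c * ‖x‖ ≤ ‖T x‖

/-- The real Banach space `L_q = L_q[0,1]`, with respect to Lebesgue measure. -/
abbrev LebesgueSpace (q : ℝ≥0∞) : Type :=
  Lp ℝ q (volume.restrict (Set.Icc (0 : ℝ) 1))

open Filter Topology

/-! Weak-* limits of difference quotients replace norm derivatives, which a Lipschitz map into a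
dual space need not have. `exists_measure_ae_of_ae_planes` provides a probability on `X`, the law of
a random series in a dense sequence `u`, for which a measurable property valid almost everywhere on
every translate of the planes in directions `u i`, `u j` holds almost surely. By Rademacher's
theorem in two variables, `f · w` is almost surely differentiable along these planes, which makes
weak-* derivatives additive on `u` when tested on `w`. For the lower bound, countably many unit-ball
vectors `v k` almost norm the increments of `f`; differentiating the integral of the supremum of
derivatives gives, almost surely, a `k` for which the derivative of `f · (v k)` along `u i` is at
least `c / 2 * ‖u i‖`.

Since `F` may be nonseparable, one point serves only finitely many arbitrary `w`, and a second
weak-* limit is taken over finite sets of vectors. Norms can drop in such limits; the lower bound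
survives because, off a set of measure less than one, `k` stays below a bound `N i` independent of
the finite set.

The bidual statement is the case `F = Y*`. For `L_1`, a Khintchine inequality bounds `∑ ‖x i‖` by
`2√n` times the average of `‖∑ ±x i‖`, and Hahn–Banach carries this to the bidual. Indicators of `m`
disjoint intervals of length `1/m` in `L_q` have norm sum `m^(1-1/q)` and signed sums of norm at
most one, so `q > 2` is impossible. -/

/-! ### Resampling coordinates of a product measure -/

theorem measurable_update_prod {ι : Type*} [DecidableEq ι] {Ω : ι → Type*}
    [∀ i, MeasurableSpace (Ω i)] (k : ι) :
    Measurable (fun p : (∀ i, Ω i) × Ω k => Function.update p.1 k p.2) := by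
  rw [measurable_pi_iff]
  intro i
  by_cases h : i = k
  · subst h
    simpa using measurable_snd
  · have : Measurable fun p : (∀ i, Ω i) × Ω k => p.1 i :=
      (measurable_pi_apply i).comp measurable_fst
    simpa [Function.update_of_ne h] using this

/-- Resampling one coordinate independently preserves an infinite product measure. -/
theorem infinitePi_map_update {ι : Type*} [DecidableEq ι] {Ω : ι → Type*}
    [∀ i, MeasurableSpace (Ω i)] (μ : ∀ i, Measure (Ω i)) [∀ i, IsProbabilityMeasure (μ i)]
    (k : ι) :
    ((Measure.infinitePi μ).prod (μ k)).map (fun p => Function.update p.1 k p.2) =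
      Measure.infinitePi μ := by
  have hm := measurable_update_prod (Ω := Ω) k
  apply Measure.eq_infinitePi
  intro s t ht
  rw [Measure.map_apply hm (MeasurableSet.pi s.countable_toSet fun i _ => ht i)]
  by_cases hk : k ∈ s
  · have : (fun p : (∀ i, Ω i) × Ω k => Function.update p.1 k p.2) ⁻¹' (Set.pi s t) =
        (Set.pi (s.erase k : Finset ι) t) ×ˢ t k := by
      ext p
      simp only [Set.mem_preimage, Set.mem_pi, Finset.mem_coe, Set.mem_prod, Finset.mem_erase]
      constructor
      · refine fun h => ⟨fun i hi => ?_, ?_⟩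
        · simpa [Function.update_of_ne hi.1] using h i hi.2
        · simpa using h k hk
      · rintro ⟨h1, h2⟩ i hi
        by_cases h : i = k
        · subst h
          simpa using h2
        · simpa [Function.update_of_ne h] using h1 i ⟨h, hi⟩
    rw [this, Measure.prod_prod, Measure.infinitePi_pi _ (fun i _ => ht i),
      Finset.prod_erase_mul _ _ hk]
  · have : (fun p : (∀ i, Ω i) × Ω k => Function.update p.1 k p.2) ⁻¹' (Set.pi s t) =
        (Set.pi s t) ×ˢ Set.univ := by
      ext p
      simp only [Set.mem_preimage, Set.mem_pi, Finset.mem_coe, Set.mem_prod, Set.mem_univ,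
        and_true]
      refine forall₂_congr fun i hi => ?_
      rw [Function.update_of_ne (by rintro rfl; exact hk hi)]
    rw [this, Measure.prod_prod, Measure.infinitePi_pi _ (fun i _ => ht i)]
    simp

theorem ae_of_ae_update {ι : Type*} [DecidableEq ι] {Ω : ι → Type*}
    [∀ i, MeasurableSpace (Ω i)] (μ : ∀ i, Measure (Ω i)) [∀ i, IsProbabilityMeasure (μ i)]
    (k : ι) {A : Set (∀ i, Ω i)}
    (h : ∀ᵐ ω ∂(Measure.infinitePi μ), ∀ᵐ s ∂(μ k), Function.update ω k s ∈ A)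
    (hA : MeasurableSet A) :
    ∀ᵐ ω ∂(Measure.infinitePi μ), ω ∈ A := by
  have hm := measurable_update_prod (Ω := Ω) k
  rw [← infinitePi_map_update μ k, ae_map_iff (p := fun ω => ω ∈ A) hm.aemeasurable hA,
    Measure.ae_prod_iff_ae_ae (hm hA)]
  exact h

theorem norm_unitInterval_smul_le {X ι : Type*} [NormedAddCommGroup X] [NormedSpace ℝ X]
    (e : ι → X) (k : ι) (s : unitInterval) : ‖(s : ℝ) • e k‖ ≤ ‖e k‖ := by
  rw [norm_smul, Real.norm_of_nonneg s.2.1]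
  exact mul_le_of_le_one_left (norm_nonneg _) s.2.2

theorem quasiMeasurePreserving_unitInterval_mul {c : ℝ} (hc : c ≠ 0) :
    Measure.QuasiMeasurePreserving (fun s : unitInterval => (s : ℝ) * c) volume volume := by
  have h1 : Measure.QuasiMeasurePreserving ((↑) : unitInterval → ℝ) volume volume :=
    unitInterval.measurePreserving_coe.quasiMeasurePreserving.mono_right
      Measure.restrict_le_self.absolutelyContinuous
  have h2 : Measure.QuasiMeasurePreserving (fun s : ℝ => s * c) volume volume := by
    refine ⟨by fun_prop, ?_⟩
    rw [Real.map_volume_mul_right hc]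
    exact Measure.smul_absolutelyContinuous
  exact h2.comp h1

/-! ### Random series and almost sure properties along planes -/

section RandomSeries

variable {X ι : Type*} [NormedAddCommGroup X] [NormedSpace ℝ X] [CompleteSpace X]

/-- The series `∑ ω k • e k` with coefficients in the unit interval. -/
noncomputable def unitSeries (e : ι → X) (ω : ι → unitInterval) : X :=
  ∑' k, (ω k : ℝ) • e k

theorem summable_unitSeries {e : ι → X} (he : Summable fun k => ‖e k‖) (ω : ι → unitInterval) :
    Summable fun k => (ω k : ℝ) • e k :=
  Summable.of_norm_bounded he fun k => norm_unitInterval_smul_le e k (ω k)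

theorem continuous_unitSeries {e : ι → X} (he : Summable fun k => ‖e k‖) :
    Continuous (unitSeries e) :=
  continuous_tsum (fun k => by fun_prop) he fun k ω => norm_unitInterval_smul_le e k (ω k)

theorem unitSeries_update [DecidableEq ι] {e : ι → X} (he : Summable fun k => ‖e k‖)
    (ω : ι → unitInterval) (k : ι) (s : unitInterval) :
    unitSeries e (Function.update ω k s) = unitSeries e ω + ((s : ℝ) - ω k) • e k := by
  rw [← sub_eq_iff_eq_add', unitSeries, unitSeries,
    ← (summable_unitSeries he _).tsum_sub (summable_unitSeries he _), tsum_eq_single k]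
  · simp [sub_smul]
  · intro i hi
    simp [Function.update_of_ne hi]

/-- Resampling coordinates `a` and `b` moves the sum within a translate of the plane of `v` and `w`,
with absolutely continuous parameters. Since the law is unchanged by resampling, a null set on every
such plane is null for the law. -/
theorem ae_unitSeries_mem [MeasurableSpace X] [BorelSpace X] [Countable ι]
    {e : ι → X} (he : Summable fun k => ‖e k‖) {a b : ι} (hab : a ≠ b) {v w : X}
    {c d : ℝ} (hc : c ≠ 0) (hd : d ≠ 0) (hv : e a = c • v) (hw : e b = d • w) {A : Set X}
    (hA : MeasurableSet A) (h : ∀ x, ∀ᵐ t : ℝ × ℝ, x + t.1 • v + t.2 • w ∈ A) :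
    ∀ᵐ ω ∂(Measure.infinitePi fun _ : ι => (volume : Measure unitInterval)),
      unitSeries e ω ∈ A := by
  classical
  have hΦ : Measurable (unitSeries e) := (continuous_unitSeries he).measurable
  have hab' : b ≠ a := hab.symm
  have hmem : MeasurableSet {ω : ι → unitInterval | unitSeries e ω ∈ A} := hΦ hA
  have key : ∀ ω : ι → unitInterval, ∀ᵐ s : unitInterval, ∀ᵐ t : unitInterval,
      unitSeries e (Function.update (Function.update ω a s) b t) ∈ A := by
    intro ω
    have h0 := h (unitSeries e ω - (ω a : ℝ) • e a - (ω b : ℝ) • e b)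
    have h1 := (MeasureTheory.QuasiMeasurePreserving.prodMap (quasiMeasurePreserving_unitInterval_mul hc)
      (quasiMeasurePreserving_unitInterval_mul hd)).ae h0
    filter_upwards [Measure.ae_ae_of_ae_prod h1] with s hs
    filter_upwards [hs] with t ht
    rw [unitSeries_update he, unitSeries_update he, Function.update_of_ne hab']
    convert ht using 1
    simp only [Prod.map_apply, mul_smul, ← hv, ← hw, sub_smul]
    abel
  refine ae_of_ae_update (fun _ => volume) b ?_ hmem
  have h2 : ∀ᵐ ω ∂(Measure.infinitePi fun _ : ι => (volume : Measure unitInterval)),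
      ω ∈ {ω : ι → unitInterval | ∀ᵐ t : unitInterval,
        Function.update ω b t ∈ {ω : ι → unitInterval | unitSeries e ω ∈ A}} := by
    refine ae_of_ae_update (fun _ => volume) a (Filter.Eventually.of_forall key) ?_
    have hm : MeasurableSet ((fun p : (ι → unitInterval) × unitInterval =>
        Function.update p.1 b p.2) ⁻¹' {ω : ι → unitInterval | unitSeries e ω ∈ A}) :=
      measurable_update_prod (Ω := fun _ : ι => unitInterval) b hmem
    -- The set is where the measure of the complementary section, a measurable function of `ω`,
    -- vanishes.
    exact measurable_measure_prodMk_left hm.compl (measurableSet_singleton 0)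
  exact h2

end RandomSeries

theorem exists_measure_ae_of_ae_planes (X : Type*) [NormedAddCommGroup X] [NormedSpace ℝ X]
    [CompleteSpace X] [TopologicalSpace.SeparableSpace X] [MeasurableSpace X] [BorelSpace X] :
    ∃ (u : ℕ → X) (μ : Measure X), DenseRange u ∧ IsProbabilityMeasure μ ∧
      ∀ (i j : ℕ) (A : Set X), MeasurableSet A →
        (∀ x, ∀ᵐ t : ℝ × ℝ, x + t.1 • u i + t.2 • u j ∈ A) → ∀ᵐ x ∂μ, x ∈ A := by
  obtain ⟨u, hu⟩ := TopologicalSpace.exists_dense_seq X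
  obtain ⟨c, hc, hcu⟩ : ∃ c : ℕ → ℝ, (∀ j, 0 < c j) ∧ ∀ j, c j * ‖u j‖ ≤ (1 / 2) ^ j := by
    refine ⟨fun j => (1 / 2) ^ j / (1 + ‖u j‖), fun j => by positivity, fun j => ?_⟩
    have := norm_nonneg (u j)
    rw [div_mul_eq_mul_div, div_le_iff₀ (by positivity)]
    gcongr
    linarith
  -- Each `u j` occurs twice, so that two distinct coordinates are available even when `i = j`.
  obtain ⟨e, he'⟩ : ∃ e : ℕ × Bool → X, ∀ k, e k = c k.1 • u k.1 := ⟨_, fun _ => rfl⟩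
  have he : Summable fun k => ‖e k‖ := by
    have h1 := Summable.mul_of_nonneg (f := fun n : ℕ => (1 / 2 : ℝ) ^ n)
      (g := fun _ : Bool => (1 : ℝ)) summable_geometric_two (hasSum_fintype _).summable
      (fun n => pow_nonneg (by norm_num) n) (fun _ => zero_le_one)
    refine Summable.of_nonneg_of_le (fun _ => norm_nonneg _) (fun k => ?_) h1
    rw [he', norm_smul, Real.norm_of_nonneg (hc _).le, mul_one]
    exact hcu _
  have hΦ : Measurable (unitSeries e) := (continuous_unitSeries he).measurable
  refine ⟨u, (Measure.infinitePi fun _ : ℕ × Bool => (volume : Measure unitInterval)).map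
    (unitSeries e), hu, Measure.isProbabilityMeasure_map hΦ.aemeasurable, fun i j A hA h => ?_⟩
  rw [ae_map_iff (p := fun x => x ∈ A) hΦ.aemeasurable hA]
  exact ae_unitSeries_mem he (a := (i, false)) (b := (j, true)) (by simp) (hc i).ne' (hc j).ne'
    (he' _) (he' _) hA h

/-! ### Lower bounds for derivatives, and norming sequences -/

/-- A countable family of uniformly Lipschitz real functions one of which grows with slope at least
`c` on every interval has, almost everywhere, a member with derivative close to `c`. -/
theorem ae_exists_lt_deriv_of_lipschitz {g : ℕ → ℝ → ℝ} {K : ℝ≥0}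
    (hg : ∀ k, LipschitzWith K (g k)) {c c' : ℝ} (hc : c' < c)
    (h : ∀ s t, s < t → ∃ k, c * (t - s) ≤ g k t - g k s) :
    ∀ᵐ t, ∃ k, c' < deriv (g k) t := by
  have hbd (k : ℕ) (t : ℝ) : ‖deriv (g k) t‖ ≤ K := norm_deriv_le_of_lipschitz (hg k)
  set m : ℝ → ℝ := fun t => ⨆ k, deriv (g k) t with hm
  have hbdd (t : ℝ) : BddAbove (Set.range fun k => deriv (g k) t) :=
    ⟨K, by rintro _ ⟨k, rfl⟩; exact (le_abs_self _).trans (hbd k t)⟩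
  have hle (k : ℕ) (t : ℝ) : deriv (g k) t ≤ m t := le_ciSup (hbdd t) k
  have hmm : Measurable m := Measurable.iSup fun k => measurable_deriv (g k)
  have hmb (t : ℝ) : ‖m t‖ ≤ K := by
    rw [Real.norm_eq_abs, abs_le]
    exact ⟨(neg_le_of_abs_le (hbd 0 t)).trans (hle 0 t),
      ciSup_le fun k => (le_abs_self _).trans (hbd k t)⟩
  have hint : LocallyIntegrable m volume :=
    (memLp_top_of_bound hmm.aestronglyMeasurable K (.of_forall hmb)).locallyIntegrable le_top
  have hmi (a b : ℝ) : IntervalIntegrable m volume a b :=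
    (hint.integrableOn_isCompact isCompact_uIcc).intervalIntegrable
  -- The index `k` depends on the interval; passing to the supremum `m` removes that dependence, so
  -- that Lebesgue differentiation gives `c ≤ m t` almost everywhere.
  have key : ∀ s t, s < t → c * (t - s) ≤ ∫ x in s..t, m x := by
    intro s t hst
    obtain ⟨k, hk⟩ := h s t hst
    have hac : AbsolutelyContinuousOnInterval (g k) s t :=
      ((hg k).lipschitzOnWith).absolutelyContinuousOnInterval
    rw [← hac.integral_deriv_eq_sub] at hk
    exact hk.trans (intervalIntegral.integral_mono_on hst.le hac.intervalIntegrable_deriv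
      (hmi s t) fun x _ => hle k x)
  filter_upwards [LocallyIntegrable.ae_hasDerivAt_integral hint] with t ht
  have hd := (ht t).hasDerivWithinAt (s := Set.Ioi t)
  rw [hasDerivWithinAt_iff_tendsto_slope' (by simp)] at hd
  have hct : c ≤ m t := by
    refine ge_of_tendsto hd ?_
    filter_upwards [self_mem_nhdsWithin] with x hx
    have hx' : 0 < x - t := sub_pos.2 hx
    rw [slope_def_field, intervalIntegral.integral_same, sub_zero, le_div_iff₀ hx']
    exact key t x hx
  exact exists_lt_of_lt_ciSup (hc.trans_le hct)

theorem exists_norm_le_one_le_apply {F : Type*} [NormedAddCommGroup F] [NormedSpace ℝ F]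
    (φ : StrongDual ℝ F) {r : ℝ} (hr : r < ‖φ‖) : ∃ w : F, ‖w‖ ≤ 1 ∧ r ≤ φ w := by
  obtain ⟨w, hw1, hw2⟩ := ContinuousLinearMap.exists_lt_apply_of_lt_opNorm φ hr
  rcases abs_choice (φ w) with h | h
  · exact ⟨w, hw1.le, by rw [Real.norm_eq_abs, h] at hw2; exact hw2.le⟩
  · exact ⟨-w, by simpa using hw1.le, by rw [Real.norm_eq_abs, h] at hw2; simpa using hw2.le⟩

/-- A separable set of functionals is almost normed by a sequence in the unit ball. -/
theorem exists_seq_norming {Z F : Type*} [TopologicalSpace Z] [TopologicalSpace.SeparableSpace Z]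
    [Nonempty Z] [NormedAddCommGroup F] [NormedSpace ℝ F] {G : Z → StrongDual ℝ F}
    (hG : Continuous G) :
    ∃ v : ℕ → F, (∀ k, ‖v k‖ ≤ 1) ∧ ∀ z, ∃ k, ‖G z‖ / 2 ≤ G z (v k) := by
  obtain ⟨d, hd⟩ := TopologicalSpace.exists_dense_seq Z
  have hv : ∀ n, ∃ w : F, ‖w‖ ≤ 1 ∧ 3 / 4 * ‖G (d n)‖ ≤ G (d n) w := by
    intro n
    rcases eq_or_ne (G (d n)) 0 with h0 | h0
    · exact ⟨0, by simp, by simp [h0]⟩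
    · have hpos : 0 < ‖G (d n)‖ := norm_pos_iff.2 h0
      exact exists_norm_le_one_le_apply _ (by linarith)
  choose v hv1 hv2 using hv
  refine ⟨v, hv1, fun z => ?_⟩
  rcases eq_or_ne (G z) 0 with h0 | h0
  · exact ⟨0, by simp [h0]⟩
  have hpos : 0 < ‖G z‖ := norm_pos_iff.2 h0
  -- The constants fit because `3/4 * 7/8 - 1/8 = 17/32 ≥ 1/2`.
  obtain ⟨n, hn⟩ := hd.exists_mem_open (s := {y | ‖G y - G z‖ < ‖G z‖ / 8})
    (isOpen_lt (by fun_prop) continuous_const) ⟨z, by simpa using hpos⟩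
  refine ⟨n, ?_⟩
  have hn' : ‖G (d n) - G z‖ < ‖G z‖ / 8 := hn
  have h1 : (G (d n) - G z) (v n) ≤ ‖G z‖ / 8 :=
    (le_abs_self _).trans <| ((G (d n) - G z).le_of_opNorm_le_of_le le_rfl (hv1 n)).trans
      (by linarith)
  have h2 : ‖G z‖ - ‖G (d n)‖ ≤ ‖G z‖ / 8 :=
    (norm_sub_norm_le _ _).trans (by rw [norm_sub_rev]; exact hn'.le)
  have h3 := hv2 n
  rw [_root_.sub_apply] at h1
  linarith

/-! ### Weak-* limits and difference quotients -/

/-- Bounded families of functionals converge weak-* along ultrafilters. -/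
theorem exists_tendsto_ultrafilter {ι F : Type*} [NormedAddCommGroup F] [NormedSpace ℝ F]
    (𝒰 : Ultrafilter ι) {φ : ι → StrongDual ℝ F} {C : ℝ} (hφ : ∀ i, ‖φ i‖ ≤ C) :
    ∃ ψ : StrongDual ℝ F, ∀ v, Tendsto (fun i => φ i v) 𝒰 (𝓝 (ψ v)) := by
  have hc := WeakDual.isCompact_closedBall (𝕜 := ℝ) (E := F) 0 C
  obtain ⟨ψ, -, hψ⟩ := hc.ultrafilter_le_nhds (𝒰.map fun i => StrongDual.toWeakDual (φ i)) (by
    rw [Filter.le_principal_iff, Ultrafilter.coe_map, Filter.mem_map]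
    exact Filter.univ_mem' fun i => by simpa using hφ i)
  refine ⟨WeakDual.toStrongDual ψ, fun v => ?_⟩
  exact ((WeakDual.eval_continuous v).tendsto ψ).comp hψ

/-- A Lipschitz map additive on pairs from a dense sequence and bounded below on it is a linear
embedding. -/
theorem linearlyEmbeds_of_dense {X E : Type*} [NormedAddCommGroup X] [NormedSpace ℝ X]
    [NormedAddCommGroup E] [NormedSpace ℝ E] {T : X → E} {K : ℝ≥0} (hT : LipschitzWith K T)
    {u : ℕ → X} (hu : DenseRange u) (hadd : ∀ i j, T (u i + u j) = T (u i) + T (u j))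
    {c : ℝ} (hc : 0 < c) (hlow : ∀ i, c * ‖u i‖ ≤ ‖T (u i)‖) : LinearlyEmbeds X E := by
  have hTc := hT.continuous
  have hadd' : ∀ x y, T (x + y) = T x + T y := fun x y =>
    hu.induction_on₂ (p := fun x y => T (x + y) = T x + T y)
      (isClosed_eq (by fun_prop) (by fun_prop)) hadd x y
  let A : X →+ E := AddMonoidHom.mk' T hadd'
  refine ⟨A.toRealLinearMap hTc, c, hc, fun x => ?_⟩
  exact hu.induction_on (p := fun x => c * ‖x‖ ≤ ‖T x‖) x
    (isClosed_le (by fun_prop) (by fun_prop)) hlow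

/-- A weak-* cluster point of the difference quotients of a Lipschitz map at `x`. -/
theorem exists_weakStar_differenceQuotient {X F : Type*} [NormedAddCommGroup X] [NormedSpace ℝ X]
    [NormedAddCommGroup F] [NormedSpace ℝ F] {f : X → StrongDual ℝ F} {K : ℝ≥0}
    (hf : LipschitzWith K f) (x : X) :
    ∃ T : X → StrongDual ℝ F, (∀ u, ‖T u‖ ≤ K * ‖u‖) ∧ (∀ u w, ‖T u - T w‖ ≤ K * ‖u - w‖) ∧
      ∀ (u : X) (v : F) (a : ℝ), HasLineDerivAt ℝ (fun y => f y v) a x u → T u v = a := by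
  let 𝒰 : Ultrafilter ℝ := Ultrafilter.of (𝓝[≠] (0 : ℝ))
  have h𝒰 : (𝒰 : Filter ℝ) ≤ 𝓝[≠] (0 : ℝ) := Ultrafilter.of_le _
  have hq (t : ℝ) (y z : X) (r : X) (hr : y - z = t • r) : ‖t⁻¹ • (f y - f z)‖ ≤ K * ‖r‖ := by
    have h1 : ‖f y - f z‖ ≤ K * (|t| * ‖r‖) := by
      have := hf.norm_sub_le y z
      rwa [hr, norm_smul, Real.norm_eq_abs] at this
    rw [norm_smul, norm_inv, Real.norm_eq_abs]
    rcases eq_or_ne t 0 with rfl | ht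
    · simp only [abs_zero, inv_zero, zero_mul]
      positivity
    · have : 0 < |t| := abs_pos.2 ht
      rw [inv_mul_le_iff₀ this]
      linarith
  have hφ (u : X) (t : ℝ) : ‖t⁻¹ • (f (x + t • u) - f x)‖ ≤ K * ‖u‖ :=
    hq t _ _ u (by abel)
  choose T hT using fun u => exists_tendsto_ultrafilter 𝒰 (hφ u)
  refine ⟨T, fun u => ?_, fun u w => ?_, fun u v a ha => ?_⟩
  · refine ContinuousLinearMap.opNorm_le_bound _ (by positivity) fun v => ?_
    refine le_of_tendsto (hT u v).norm (.of_forall fun t => ?_)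
    exact (ContinuousLinearMap.le_of_opNorm_le _ (hφ u t) v)
  · refine ContinuousLinearMap.opNorm_le_bound _ (by positivity) fun v => ?_
    refine le_of_tendsto ((hT u v).sub (hT w v)).norm (.of_forall fun t => ?_)
    have h := ContinuousLinearMap.le_of_opNorm_le _
      (hq t (x + t • u) (x + t • w) (u - w) (by rw [smul_sub]; abel)) v
    rwa [show t⁻¹ • (f (x + t • u) - f (x + t • w)) =
      t⁻¹ • (f (x + t • u) - f x) - t⁻¹ • (f (x + t • w) - f x) by
        module] at h
  · refine tendsto_nhds_unique (hT u v) ?_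
    have := (hasDerivAt_iff_tendsto_slope_zero.1 ha).mono_left h𝒰
    simpa using this

/-! ### Differentiability and lower bounds along planes and lines -/

theorem hasLineDerivAt_of_differentiableAt_plane {X : Type*} [NormedAddCommGroup X]
    [NormedSpace ℝ X] {φ : X → ℝ} {x u w : X}
    (h : DifferentiableAt ℝ (fun t : ℝ × ℝ => φ (x + t.1 • u + t.2 • w)) 0) (a b : ℝ) :
    HasLineDerivAt ℝ φ (fderiv ℝ (fun t : ℝ × ℝ => φ (x + t.1 • u + t.2 • w)) 0 (a, b)) x
      (a • u + b • w) := by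
  have h1 : HasDerivAt (fun s : ℝ => s • ((a, b) : ℝ × ℝ)) ((a, b) : ℝ × ℝ) 0 := by
    simpa using (hasDerivAt_id (0 : ℝ)).smul_const ((a, b) : ℝ × ℝ)
  have h2 := h.hasFDerivAt
  rw [← zero_smul ℝ ((a, b) : ℝ × ℝ)] at h2
  have h3 := h2.comp_hasDerivAt (0 : ℝ) h1
  rw [zero_smul] at h3
  unfold HasLineDerivAt
  convert h3 using 1
  ext s
  simp [smul_add, mul_smul, add_assoc]

theorem measurableSet_differentiableAt_plane {X : Type*} [NormedAddCommGroup X] [NormedSpace ℝ X]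
    [MeasurableSpace X] [BorelSpace X] {φ : X → ℝ} (hφ : Continuous φ) (u w : X) :
    MeasurableSet {x | DifferentiableAt ℝ (fun t : ℝ × ℝ => φ (x + t.1 • u + t.2 • w)) 0} := by
  let g : X → ℝ × ℝ → ℝ := fun x t => φ (x + t.1 • u + t.2 • w)
  have hg : Continuous g.uncurry := by fun_prop
  exact measurable_prodMk_right (measurableSet_of_differentiableAt_with_param ℝ hg)

theorem ae_differentiableAt_plane {X : Type*} [NormedAddCommGroup X] [NormedSpace ℝ X]
    {φ : X → ℝ} {K : ℝ≥0} (hφ : LipschitzWith K φ) (x u w : X) :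
    ∀ᵐ t : ℝ × ℝ, x + t.1 • u + t.2 • w ∈
      {y | DifferentiableAt ℝ (fun t : ℝ × ℝ => φ (y + t.1 • u + t.2 • w)) 0} := by
  let A : ℝ × ℝ →L[ℝ] X := (ContinuousLinearMap.fst ℝ ℝ ℝ).smulRight u +
    (ContinuousLinearMap.snd ℝ ℝ ℝ).smulRight w
  filter_upwards [(hφ.comp ((LipschitzWith.const x).add A.lipschitz)).ae_differentiableAt
    (μ := volume)] with t ht
  rw [← add_zero t] at ht
  have h1 := ht.comp (0 : ℝ × ℝ) (differentiableAt_id.const_add t)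
  have h2 : (fun s : ℝ × ℝ => φ (x + t.1 • u + t.2 • w + s.1 • u + s.2 • w)) =
      (φ ∘ fun y => x + A y) ∘ fun s => t + id s := by
    ext s
    refine congrArg φ ?_
    change _ = x + ((t.1 + s.1) • u + (t.2 + s.2) • w)
    module
  exact h2 ▸ h1

theorem ae_exists_le_lineDeriv {X F : Type*} [NormedAddCommGroup X] [NormedSpace ℝ X]
    [NormedAddCommGroup F] [NormedSpace ℝ F] {f : X → StrongDual ℝ F} {K : ℝ≥0} (hf : LipschitzWith K f)
    {v : ℕ → F} (hv : ∀ k, ‖v k‖ ≤ 1) {c : ℝ} (hc : 0 < c)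
    (h : ∀ x y, ∃ k, c * ‖x - y‖ ≤ (f x - f y) (v k)) (x u : X) :
    ∀ᵐ t : ℝ, ∃ k, c / 2 * ‖u‖ ≤ lineDeriv ℝ (fun y => f y (v k)) (x + t • u) u := by
  rcases eq_or_ne u 0 with rfl | hu
  · simp [lineDeriv]
  have hu' : 0 < ‖u‖ := norm_pos_iff.2 hu
  have hg (k : ℕ) : LipschitzWith (K * ‖u‖₊) fun t : ℝ => f (x + t • u) (v k) := by
    refine LipschitzWith.of_dist_le_mul fun s t => ?_
    rw [Real.dist_eq, ← _root_.sub_apply, ← Real.norm_eq_abs]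
    refine (ContinuousLinearMap.le_of_opNorm_le_of_le _ (hf.norm_sub_le _ _) (hv k)).trans ?_
    rw [add_sub_add_left_eq_sub, ← sub_smul, norm_smul, Real.dist_eq, ← Real.norm_eq_abs]
    push_cast
    exact le_of_eq (by ring)
  have := ae_exists_lt_deriv_of_lipschitz hg (c := c * ‖u‖) (c' := c / 2 * ‖u‖)
    (by nlinarith) (fun s t hst => by
      obtain ⟨k, hk⟩ := h (x + t • u) (x + s • u)
      refine ⟨k, ?_⟩
      rw [add_sub_add_left_eq_sub, ← sub_smul, norm_smul, Real.norm_of_nonneg (sub_pos.2 hst).le,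
        _root_.sub_apply] at hk
      linarith)
  filter_upwards [this] with t ⟨k, hk⟩
  refine ⟨k, hk.le.trans_eq ?_⟩
  have h1 := deriv_comp_const_add (f := fun t : ℝ => f (x + t • u) (v k)) t 0
  rw [add_zero] at h1
  rw [lineDeriv, ← h1]
  simp only [add_smul, add_assoc]

/-- Continuity from above for a finite measure: it trades an almost sure index for a uniformly
bounded one, at the cost of a small exceptional set. -/
theorem exists_measure_forall_lt_notMem_lt {X : Type*} [MeasurableSpace X] {μ : Measure X}
    [IsFiniteMeasure μ] {P : ℕ → Set X} (hP : ∀ k, MeasurableSet (P k))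
    (h : ∀ᵐ x ∂μ, ∃ k, x ∈ P k) {δ : ℝ≥0∞} (hδ : δ ≠ 0) :
    ∃ N, μ {x | ∀ k < N, x ∉ P k} < δ := by
  have hm (N : ℕ) : MeasurableSet {x | ∀ k < N, x ∉ P k} := by
    have : {x | ∀ k < N, x ∉ P k} = ⋂ k, ⋂ (_ : k < N), (P k)ᶜ := by ext; simp
    rw [this]
    exact MeasurableSet.iInter fun k => MeasurableSet.iInter fun _ => (hP k).compl
  have ht := tendsto_measure_iInter_atTop (μ := μ) (fun N => (hm N).nullMeasurableSet)
    (fun M N hMN x hx k hk => hx k (hk.trans_le hMN)) ⟨0, measure_ne_top _ _⟩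
  have h0 : μ (⋂ N, {x | ∀ k < N, x ∉ P k}) = 0 := by
    refine measure_mono_null (fun x hx => ?_) h
    simp only [Set.mem_iInter, Set.mem_ofPred_eq] at hx
    rintro ⟨k, hk⟩
    exact hx (k + 1) k (Nat.lt_succ_self k) hk
  rw [h0] at ht
  exact (ht.eventually_lt_const hδ.bot_lt).exists

/-! ### Linear embedding into a dual space -/

theorem linearlyEmbeds_dual_of_lipschitzEmbeds (X : Type*) [NormedAddCommGroup X] [NormedSpace ℝ X]
    [CompleteSpace X] [TopologicalSpace.SeparableSpace X]
    (F : Type*) [NormedAddCommGroup F] [NormedSpace ℝ F]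
    (hXF : LipschitzEmbeds X (StrongDual ℝ F)) : LinearlyEmbeds X (StrongDual ℝ F) := by
  obtain ⟨f, ⟨K, hK⟩, L, hL⟩ := hXF
  borelize X
  obtain ⟨u, μ, hu, hμ, hplane⟩ := exists_measure_ae_of_ae_planes X
  obtain ⟨v, hv, hnorming⟩ := exists_seq_norming (G := fun p : X × X => f p.1 - f p.2)
    ((hK.continuous.comp continuous_fst).sub (hK.continuous.comp continuous_snd))
  obtain ⟨c, hc, hlow⟩ : ∃ c : ℝ, 0 < c ∧ ∀ x y, ∃ k, c * ‖x - y‖ ≤ (f x - f y) (v k) := by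
    -- The factor 2 is the loss in `hnorming`; `L + 1` guards against `L = 0`.
    refine ⟨1 / (2 * (L + 1)), by positivity, fun x y => ?_⟩
    obtain ⟨k, hk⟩ := hnorming (x, y)
    refine ⟨k, le_trans ?_ hk⟩
    have h1 : ‖x - y‖ ≤ L * ‖f x - f y‖ := by
      simpa [dist_eq_norm] using hL.le_mul_dist x y
    have h2 := norm_nonneg (f x - f y)
    rw [div_mul_eq_mul_div, div_le_div_iff₀ (by positivity) two_pos]
    nlinarith
  have hev (w : F) : LipschitzWith (‖w‖₊ * K) fun y => f y w := by
    refine LipschitzWith.of_dist_le_mul fun x y => ?_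
    rw [Real.dist_eq, ← _root_.sub_apply, ← Real.norm_eq_abs, dist_eq_norm]
    refine (ContinuousLinearMap.le_of_opNorm_le _ (hK.norm_sub_le _ _) w).trans ?_
    push_cast
    exact le_of_eq (by ring)
  have hdiff (i j : ℕ) (w : F) : ∀ᵐ x ∂μ,
      DifferentiableAt ℝ (fun t : ℝ × ℝ => f (x + t.1 • u i + t.2 • u j) w) 0 :=
    hplane i j _ (measurableSet_differentiableAt_plane (hev w).continuous _ _)
      fun x => ae_differentiableAt_plane (hev w) x _ _
  let P : ℕ → ℕ → Set X := fun i k =>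
    {x | c / 2 * ‖u i‖ ≤ lineDeriv ℝ (fun y => f y (v k)) x (u i)}
  have hP (i k : ℕ) : MeasurableSet (P i k) :=
    measurableSet_le measurable_const (measurable_lineDeriv (hev (v k)).continuous)
  have hPae (i : ℕ) : ∀ᵐ x ∂μ, ∃ k, x ∈ P i k := by
    have hm : MeasurableSet {x | ∃ k, x ∈ P i k} := by
      have : {x | ∃ k, x ∈ P i k} = ⋃ k, P i k := by ext; simp
      rw [this]
      exact MeasurableSet.iUnion (hP i)
    -- With both directions equal to `u i`, fixing the first parameter leaves a line, and Fubini
    -- reduces the claim to lines.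
    refine hplane i i _ hm fun x => ?_
    have hmt : MeasurableSet {t : ℝ × ℝ | x + t.1 • u i + t.2 • u i ∈ {x | ∃ k, x ∈ P i k}} :=
      (by fun_prop : Continuous fun t : ℝ × ℝ => x + t.1 • u i + t.2 • u i).measurable hm
    refine (Measure.ae_prod_iff_ae_ae hmt).2 ?_
    exact .of_forall fun s => ae_exists_le_lineDeriv hK hv hc hlow (x + s • u i) (u i)
  obtain ⟨δ, hδ, hδsum⟩ := ENNReal.exists_pos_sum_of_countable' (one_ne_zero : (1 : ℝ≥0∞) ≠ 0) ℕ
  choose N hN using fun i => exists_measure_forall_lt_notMem_lt (hP i) (hPae i) (hδ i).ne'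
  have hbad : μ (⋃ i, {x | ∀ k < N i, x ∉ P i k}) < 1 :=
    ((measure_iUnion_le _).trans (ENNReal.tsum_le_tsum fun i => (hN i).le)).trans_lt hδsum
  -- The bounds `N i` are fixed before `S`. Almost sure differentiability and `hbad` leave a good
  -- base point for each `S`.
  have hT : ∀ S : Finset F, ∃ T : X → StrongDual ℝ F, (∀ x, ‖T x‖ ≤ K * ‖x‖) ∧
      (∀ x y, ‖T x - T y‖ ≤ K * ‖x - y‖) ∧
      (∀ w ∈ S, ∀ i j, T (u i + u j) w = T (u i) w + T (u j) w) ∧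
      ∀ i, ∃ k < N i, c / 2 * ‖u i‖ ≤ T (u i) (v k) := by
    intro S
    have h1 : ∀ᵐ x ∂μ, ∀ i j, (∀ w ∈ S, DifferentiableAt ℝ
        (fun t : ℝ × ℝ => f (x + t.1 • u i + t.2 • u j) w) 0) ∧ ∀ k, DifferentiableAt ℝ
        (fun t : ℝ × ℝ => f (x + t.1 • u i + t.2 • u j) (v k)) 0 := by
      refine ae_all_iff.2 fun i => ae_all_iff.2 fun j => Filter.Eventually.and ?_ ?_
      · exact (eventually_all_finset S).2 fun w _ => hdiff i j w
      · exact ae_all_iff.2 fun k => hdiff i j (v k)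
    obtain ⟨x, hx1, hx2⟩ : ∃ x, (∀ i j, (∀ w ∈ S, DifferentiableAt ℝ
        (fun t : ℝ × ℝ => f (x + t.1 • u i + t.2 • u j) w) 0) ∧ ∀ k, DifferentiableAt ℝ
        (fun t : ℝ × ℝ => f (x + t.1 • u i + t.2 • u j) (v k)) 0) ∧
        x ∉ ⋃ i, {x | ∀ k < N i, x ∉ P i k} := by
      by_contra! hcon
      have h2 : μ Set.univ ≤ μ (⋃ i, {x | ∀ k < N i, x ∉ P i k}) :=
        measure_mono_ae (h1.mono fun x hx _ => hcon x hx)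
      rw [measure_univ] at h2
      exact hbad.not_ge h2
    obtain ⟨T, hT1, hT2, hT3⟩ := exists_weakStar_differenceQuotient hK x
    refine ⟨T, hT1, hT2, fun w hw i j => ?_, fun i => ?_⟩
    · have hd := hasLineDerivAt_of_differentiableAt_plane (φ := fun y => f y w) ((hx1 i j).1 w hw)
      have e1 := hT3 _ _ _ (hd 1 1)
      have e2 := hT3 _ _ _ (hd 1 0)
      have e3 := hT3 _ _ _ (hd 0 1)
      simp only [one_smul, zero_smul, add_zero, zero_add] at e1 e2 e3
      rw [e1, e2, e3, ← map_add]
      simp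
    · simp only [Set.mem_iUnion, Set.mem_ofPred_eq, not_exists, not_forall, not_not] at hx2
      obtain ⟨k, hk, hxk⟩ := hx2 i
      refine ⟨k, hk, ?_⟩
      -- Differentiability identifies the `lineDeriv` in `P i k`, which could otherwise be a default
      -- value, with `T (u i) (v k)`.
      have hd := hasLineDerivAt_of_differentiableAt_plane (φ := fun y => f y (v k)) ((hx1 i i).2 k) 1 0
      simp only [one_smul, zero_smul, add_zero] at hd
      rw [hT3 _ _ _ hd, ← hd.lineDeriv]
      exact hxk
  choose T hT1 hT2 hT3 hT4 using hT
  let 𝒰 : Ultrafilter (Finset F) := Ultrafilter.of atTop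
  have h𝒰 : (𝒰 : Filter (Finset F)) ≤ atTop := Ultrafilter.of_le _
  choose T' hT' using fun x => exists_tendsto_ultrafilter 𝒰 (fun S => hT1 S x)
  refine linearlyEmbeds_of_dense (T := T') (K := K) ?_ hu (fun i j => ?_) (half_pos hc)
    fun i => ?_
  · refine LipschitzWith.of_dist_le_mul fun x y => ?_
    rw [dist_eq_norm, dist_eq_norm]
    refine ContinuousLinearMap.opNorm_le_bound _ (by positivity) fun w => ?_
    exact le_of_tendsto ((hT' x w).sub (hT' y w)).norm
      (.of_forall fun S => ContinuousLinearMap.le_of_opNorm_le _ (hT2 S x y) w)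
  · ext w
    refine tendsto_nhds_unique (hT' _ w) (((hT' _ w).add (hT' _ w)).congr' ?_)
    filter_upwards [h𝒰 (eventually_ge_atTop {w})] with S hS
    exact (hT3 S w (hS (by simp)) i j).symm
  · obtain ⟨k, hk⟩ : ∃ k, c / 2 * ‖u i‖ ≤ T' (u i) (v k) := by
      -- If all the limits were too small, the finitely many strict inequalities for `k < N i` would
      -- hold together at some `S`, contradicting `hT4`.
      by_contra! hcon
      have h1 : ∀ᶠ S in (𝒰 : Filter (Finset F)), ∀ k ∈ Finset.range (N i),
          T S (u i) (v k) < c / 2 * ‖u i‖ :=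
        (eventually_all_finset _).2 fun k _ => (hT' (u i) (v k)).eventually_lt_const (hcon k)
      obtain ⟨S, hS⟩ := h1.exists
      obtain ⟨k, hk, hle⟩ := hT4 S i
      exact (hS k (Finset.mem_range.2 hk)).not_ge hle
    exact hk.trans ((le_abs_self _).trans (((T' (u i)).le_of_opNorm_le_of_le le_rfl (hv k)).trans
      (by rw [mul_one])))

theorem linearlyEmbeds_bidual_of_lipschitzEmbeds (X : Type*) [NormedAddCommGroup X]
    [NormedSpace ℝ X] [CompleteSpace X] [TopologicalSpace.SeparableSpace X]
    (Y : Type*) [NormedAddCommGroup Y] [NormedSpace ℝ Y] (hXY : LipschitzEmbeds X Y) :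
    LinearlyEmbeds X (StrongDual ℝ (StrongDual ℝ Y)) := by
  obtain ⟨f, ⟨K, hK⟩, L, hL⟩ := hXY
  have hi := (NormedSpace.inclusionInDoubleDualLi (𝕜 := ℝ) (E := Y)).isometry
  exact linearlyEmbeds_dual_of_lipschitzEmbeds X (StrongDual ℝ Y)
    ⟨_, ⟨_, hi.lipschitz.comp hK⟩, _, hi.antilipschitz.comp hL⟩

/-! ### Rademacher sums in `L_1` and its bidual -/

/-- The sign attached to a Boolean. -/
def boolSign (b : Bool) : ℝ := if b then 1 else -1

theorem abs_boolSign (b : Bool) : |boolSign b| = 1 := by cases b <;> simp [boolSign]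

theorem sum_fin_succ_bool {n : ℕ} (G : (Fin (n + 1) → Bool) → ℝ) :
    ∑ ε, G ε = ∑ ε : Fin n → Bool, (G (Fin.cons true ε) + G (Fin.cons false ε)) := by
  rw [← (Fin.consEquiv fun _ => Bool).sum_comp G, Fintype.sum_prod_type, Fintype.sum_bool,
    ← Finset.sum_add_distrib]
  rfl

theorem sum_boolSign_sq {n : ℕ} (a : Fin n → ℝ) :
    ∑ ε : Fin n → Bool, (∑ i, boolSign (ε i) * a i) ^ 2 = 2 ^ n * ∑ i, a i ^ 2 := by
  induction n with
  | zero => simp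
  | succ n ih =>
    rw [sum_fin_succ_bool, Fin.sum_univ_succ (fun i => a i ^ 2), mul_add, pow_succ]
    have h (ε : Fin n → Bool) :
        (∑ i, boolSign ((Fin.cons true ε : Fin (n + 1) → Bool) i) * a i) ^ 2 +
          (∑ i, boolSign ((Fin.cons false ε : Fin (n + 1) → Bool) i) * a i) ^ 2 =
        2 * (∑ i, boolSign (ε i) * a i.succ) ^ 2 + 2 * a 0 ^ 2 := by
      simp only [Fin.sum_univ_succ, Fin.cons_zero, Fin.cons_succ, boolSign, if_true,
        Bool.false_eq_true, if_false]
      ring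
    rw [Finset.sum_congr rfl fun ε _ => h ε, Finset.sum_add_distrib, ← Finset.mul_sum,
      ih fun i => a i.succ]
    simp
    ring

/-- Averaging over the first sign kills odd powers; the mixed term `6 a₀² A` is exactly that of `3
(a₀² + A)²`, where `A` is the sum of the other squares. -/
theorem sum_boolSign_pow_four_le {n : ℕ} (a : Fin n → ℝ) :
    ∑ ε : Fin n → Bool, (∑ i, boolSign (ε i) * a i) ^ 4 ≤ 2 ^ n * (3 * (∑ i, a i ^ 2) ^ 2) := by
  induction n with
  | zero => simp
  | succ n ih =>
    rw [sum_fin_succ_bool, Fin.sum_univ_succ (fun i => a i ^ 2), pow_succ]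
    have h (ε : Fin n → Bool) :
        (∑ i, boolSign ((Fin.cons true ε : Fin (n + 1) → Bool) i) * a i) ^ 4 +
          (∑ i, boolSign ((Fin.cons false ε : Fin (n + 1) → Bool) i) * a i) ^ 4 =
        2 * (∑ i, boolSign (ε i) * a i.succ) ^ 4 +
          12 * a 0 ^ 2 * (∑ i, boolSign (ε i) * a i.succ) ^ 2 + 2 * a 0 ^ 4 := by
      simp only [Fin.sum_univ_succ, Fin.cons_zero, Fin.cons_succ, boolSign, if_true,
        Bool.false_eq_true, if_false]
      ring
    rw [Finset.sum_congr rfl fun ε _ => h ε, Finset.sum_add_distrib, Finset.sum_add_distrib,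
      ← Finset.mul_sum, ← Finset.mul_sum, sum_boolSign_sq fun i => a i.succ]
    have h4 := ih fun i => a i.succ
    have h5 : 0 ≤ (2 : ℝ) ^ n * a 0 ^ 4 := by positivity
    simp only [Finset.sum_const, Finset.card_univ, Fintype.card_pi, Fintype.card_bool,
      Finset.prod_const, Fintype.card_fin, nsmul_eq_mul, Nat.cast_pow, Nat.cast_ofNat]
    nlinarith

/-- A form of Khintchine's inequality comparing the first absolute moment of a Rademacher sum with
the `ℓ¹` norm of its coefficients. -/
theorem sum_abs_le_sum_abs_boolSign {n : ℕ} (a : Fin n → ℝ) :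
    ∑ i, |a i| ≤ 2 * √n / 2 ^ n * ∑ ε : Fin n → Bool, |∑ i, boolSign (ε i) * a i| := by
  set A := ∑ i, a i ^ 2 with hA
  have hA0 : 0 ≤ A := Finset.sum_nonneg fun i _ => sq_nonneg _
  have h1 : ∑ i, |a i| ≤ √n * √A := by
    rw [← Real.sqrt_mul (Nat.cast_nonneg n)]
    refine Real.le_sqrt_of_sq_le ?_
    simpa using sq_sum_le_card_mul_sum_sq (s := Finset.univ) (f := fun i => |a i|)
  have h2 : 2 ^ n * √A ≤ 2 * ∑ ε : Fin n → Bool, |∑ i, boolSign (ε i) * a i| := by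
    rcases hA0.eq_or_lt with h0 | hpos
    · rw [← h0]
      simp only [Real.sqrt_zero, mul_zero]
      positivity
    set R := √A with hR
    have hRpos : 0 < R := Real.sqrt_pos.2 hpos
    have hRA : R ^ 2 = A := Real.sq_sqrt hA0
    -- The two sides touch at `|s| = 2R`, whence the squared factor. Averaging with the second and
    -- fourth moments leaves `3/4 - 3/16 = 9/16 ≥ 1/2` times `R ^ 4`.
    have hpt (s : ℝ) : 3 / 4 * R ^ 2 * s ^ 2 - s ^ 4 / 16 ≤ R ^ 3 * |s| := by
      have h : 0 ≤ |s| * ((|s| - 2 * R) ^ 2 * (|s| + 4 * R)) := by positivity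
      have e2 : s ^ 2 = |s| ^ 2 := (sq_abs s).symm
      have e4 : s ^ 4 = |s| ^ 4 := by rw [show s ^ 4 = (s ^ 2) ^ 2 by ring, e2]; ring
      rw [e2, e4]
      nlinarith
    have hsum := Finset.sum_le_sum fun (ε : Fin n → Bool) (_ : ε ∈ Finset.univ) =>
      hpt (∑ i, boolSign (ε i) * a i)
    rw [Finset.sum_sub_distrib, ← Finset.mul_sum, ← Finset.mul_sum, ← Finset.sum_div,
      sum_boolSign_sq, ← hA, ← hRA] at hsum
    have h4 := sum_boolSign_pow_four_le a
    rw [← hA, ← hRA] at h4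
    have hp : 0 ≤ (2 : ℝ) ^ n * R ^ 4 := by positivity
    have h3 : R ^ 3 * (2 ^ n * R) ≤
        R ^ 3 * (2 * ∑ ε : Fin n → Bool, |∑ i, boolSign (ε i) * a i|) := by nlinarith
    exact le_of_mul_le_mul_left h3 (by positivity)
  calc ∑ i, |a i| ≤ √n * √A := h1
    _ = √n / 2 ^ n * (2 ^ n * √A) := by field_simp
    _ ≤ √n / 2 ^ n * (2 * ∑ ε : Fin n → Bool, |∑ i, boolSign (ε i) * a i|) := by gcongr
    _ = _ := by ring

theorem coeFn_sum_boolSign_smul {α : Type*} [MeasurableSpace α] {μ : Measure α} {p : ℝ≥0∞} {n : ℕ}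
    (x : Fin n → Lp ℝ p μ) (ε : Fin n → Bool) :
    ∀ᵐ t ∂μ, (∑ i, boolSign (ε i) • x i : Lp ℝ p μ) t = ∑ i, boolSign (ε i) * x i t := by
  have h1 := Lp.coeFn_finsetSum Finset.univ fun i => boolSign (ε i) • x i
  have h2 : ∀ᵐ t ∂μ, ∀ i, (boolSign (ε i) • x i : Lp ℝ p μ) t = boolSign (ε i) * x i t :=
    ae_all_iff.2 fun i => by
      filter_upwards [Lp.coeFn_smul (boolSign (ε i)) (x i)] with t ht
      simpa using ht
  filter_upwards [h1, h2] with t ht1 ht2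
  rw [ht1]
  simp [ht2]

theorem sum_norm_le_sum_norm_boolSign_L1 {α : Type*} [MeasurableSpace α] {μ : Measure α} {n : ℕ}
    (x : Fin n → Lp ℝ 1 μ) :
    ∑ i, ‖x i‖ ≤ 2 * √n / 2 ^ n * ∑ ε : Fin n → Bool, ‖∑ i, boolSign (ε i) • x i‖ := by
  simp only [L1.norm_eq_integral_norm]
  rw [← integral_finsetSum _ fun i _ => (L1.integrable_coeFn (x i)).norm,
    ← integral_finsetSum _ fun ε _ => (L1.integrable_coeFn (∑ i, boolSign (ε i) • x i)).norm,
    ← integral_const_mul]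
  refine integral_mono_ae (integrable_finsetSum _ fun i _ => (L1.integrable_coeFn (x i)).norm)
    ((integrable_finsetSum _ fun ε _ =>
      (L1.integrable_coeFn (∑ i, boolSign (ε i) • x i)).norm).const_mul _) ?_
  filter_upwards [ae_all_iff.2 fun ε => coeFn_sum_boolSign_smul x ε] with t ht
  simp only [ht, Real.norm_eq_abs]
  exact sum_abs_le_sum_abs_boolSign fun i => x i t

/-- A lower estimate for Rademacher sums passes from a space to its bidual. -/
theorem sum_norm_le_sum_norm_boolSign_bidual {E : Type*} [NormedAddCommGroup E] [NormedSpace ℝ E]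
    {n : ℕ} {C : ℝ} (hC : 0 ≤ C)
    (h : ∀ x : Fin n → E, ∑ i, ‖x i‖ ≤ C * ∑ ε : Fin n → Bool, ‖∑ i, boolSign (ε i) • x i‖)
    (z : Fin n → StrongDual ℝ (StrongDual ℝ E)) :
    ∑ i, ‖z i‖ ≤ C * ∑ ε : Fin n → Bool, ‖∑ i, boolSign (ε i) • z i‖ := by
  have key : ∀ y : Fin n → StrongDual ℝ E, (∀ i, ‖y i‖ ≤ 1) →
      ∑ i, z i (y i) ≤ C * ∑ ε : Fin n → Bool, ‖∑ i, boolSign (ε i) • z i‖ := by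
    intro y hy
    -- The hypothesis makes `J` bounded below, so `y` defines a dominated functional on its range.
    -- The components `G ε` of a Hahn–Banach extension have norm at most `C` and satisfy `y i = ∑ ε,
    -- boolSign (ε i) • G ε`, and `z` can be paired with this expansion.
    let J : (Fin n → E) →ₗ[ℝ] ((Fin n → Bool) → E) :=
      LinearMap.pi fun ε => ∑ i, boolSign (ε i) • LinearMap.proj i
    have hJ (x : Fin n → E) (ε : Fin n → Bool) : J x ε = ∑ i, boolSign (ε i) • x i := by
      simp [J]
    have hJinj : Function.Injective J := by
      rw [← LinearMap.ker_eq_bot, LinearMap.ker_eq_bot']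
      intro x hx
      have h1 := h x
      simp only [← hJ, hx, Pi.zero_apply, norm_zero, Finset.sum_const_zero, mul_zero] at h1
      ext i
      have h2 := (Finset.sum_eq_zero_iff_of_nonneg fun i _ => norm_nonneg (x i)).1
        (le_antisymm h1 (Finset.sum_nonneg fun i _ => norm_nonneg (x i))) i (Finset.mem_univ i)
      simpa using h2
    let Y : (Fin n → E) →ₗ[ℝ] ℝ := ∑ i, (y i : E →ₗ[ℝ] ℝ) ∘ₗ LinearMap.proj i
    have hY (x : Fin n → E) : Y x = ∑ i, y i (x i) := by simp [Y]
    let p : Seminorm ℝ ((Fin n → Bool) → E) := Seminorm.of (fun g => C * ∑ ε, ‖g ε‖)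
      (fun g g' => by
        rw [← mul_add, ← Finset.sum_add_distrib]
        exact mul_le_mul_of_nonneg_left (Finset.sum_le_sum fun ε _ => norm_add_le _ _) hC)
      (fun r g => by
        simp only [Pi.smul_apply, norm_smul, ← Finset.mul_sum]
        ring)
    obtain ⟨g, hg1, hg2⟩ := Module.Dual.exists_extension_of_le_seminorm_real (LinearMap.range J)
      (Y ∘ₗ (LinearEquiv.ofInjective J hJinj).symm.toLinearMap) (p := p) (by
        rintro ⟨_, x, rfl⟩
        have e : (LinearEquiv.ofInjective J hJinj).symm ⟨J x, x, rfl⟩ = x :=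
          (LinearEquiv.symm_apply_eq _).2 rfl
        change Y ((LinearEquiv.ofInjective J hJinj).symm ⟨J x, x, rfl⟩) ≤ C * ∑ ε, ‖J x ε‖
        rw [e, hY]
        simp only [hJ]
        refine le_trans (Finset.sum_le_sum fun i _ => ?_) (h x)
        exact (le_abs_self _).trans (((y i).le_of_opNorm_le (hy i) (x i)).trans_eq (one_mul _)))
    have hgJ (x : Fin n → E) : g (J x) = ∑ i, y i (x i) := by
      have e : (LinearEquiv.ofInjective J hJinj).symm ⟨J x, x, rfl⟩ = x :=
        (LinearEquiv.symm_apply_eq _).2 rfl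
      rw [← hY]
      refine (hg1 ⟨J x, x, rfl⟩).trans ?_
      change Y ((LinearEquiv.ofInjective J hJinj).symm ⟨J x, x, rfl⟩) = Y x
      rw [e]
    let G : (Fin n → Bool) → StrongDual ℝ E := fun ε =>
      (g ∘ₗ LinearMap.single ℝ (fun _ => E) ε).mkContinuous C fun x => by
        refine (hg2 _).trans_eq ?_
        change C * ∑ ε', ‖(Pi.single ε x : (Fin n → Bool) → E) ε'‖ = C * ‖x‖
        rw [Finset.sum_eq_single ε (fun ε' _ hε => by simp [Pi.single_eq_of_ne hε]) (by simp)]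
        simp
    have hG (ε : Fin n → Bool) (x : E) : G ε x = g (Pi.single ε x) := rfl
    have hGC (ε : Fin n → Bool) : ‖G ε‖ ≤ C := LinearMap.mkContinuous_norm_le _ hC _
    have hyG (i : Fin n) : y i = ∑ ε, boolSign (ε i) • G ε := by
      ext x
      have h1 := hgJ (Pi.single i x)
      rw [Finset.sum_eq_single i (fun j _ hj => by simp [Pi.single_eq_of_ne hj]) (by simp),
        Pi.single_eq_same] at h1
      rw [← h1, _root_.sum_apply]
      conv_lhs => rw [← Finset.univ_sum_single (J (Pi.single i x)), map_sum]
      refine Finset.sum_congr rfl fun ε _ => ?_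
      rw [_root_.smul_apply, hG, hJ, Finset.sum_eq_single i
        (fun j _ hj => by simp [Pi.single_eq_of_ne hj]) (by simp), Pi.single_eq_same, ← map_smul,
        Pi.single_smul]
    calc ∑ i, z i (y i) = ∑ ε, (∑ i, boolSign (ε i) • z i) (G ε) := by
          simp only [hyG, map_sum, map_smul, _root_.sum_apply, _root_.smul_apply]
          exact Finset.sum_comm
      _ ≤ ∑ ε : Fin n → Bool, ‖∑ i, boolSign (ε i) • z i‖ * C :=
          Finset.sum_le_sum fun ε _ => (le_abs_self _).trans
            ((∑ i, boolSign (ε i) • z i).le_of_opNorm_le_of_le le_rfl (hGC ε))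
      _ = _ := by rw [← Finset.sum_mul, mul_comm]
  refine le_of_forall_pos_le_add fun η hη => ?_
  choose y hy1 hy2 using fun i => exists_norm_le_one_le_apply (z i)
    (r := ‖z i‖ - η / (n + 1)) (sub_lt_self _ (by positivity))
  have h1 := key y hy1
  have h2 : ∑ i, (‖z i‖ - η / (n + 1)) ≤ ∑ i, z i (y i) :=
    Finset.sum_le_sum fun i _ => hy2 i
  have h3 : n * (η / (n + 1)) ≤ η := by
    rw [mul_div_assoc', div_le_iff₀ (by positivity)]
    nlinarith
  simp only [Finset.sum_sub_distrib, Finset.sum_const, Finset.card_univ, Fintype.card_fin,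
    nsmul_eq_mul] at h2
  linarith

/-! ### Step functions in `L_q` and the obstruction for `q > 2` -/

/-- The indicator function of `[i / m, (i + 1) / m)` in `L_q[0,1]`. -/
noncomputable def stepIndicator (q : ℝ≥0∞) (m i : ℕ) : LebesgueSpace q :=
  indicatorConstLp q (measurableSet_Ico (a := (i : ℝ) / m) (b := ((i : ℝ) + 1) / m))
    (measure_ne_top _ _) 1

theorem norm_stepIndicator {q : ℝ≥0∞} (hq : q ≠ 0) {m i : ℕ} (hi : i < m) :
    ‖stepIndicator q m i‖ = (1 / (m : ℝ)) ^ (1 / q.toReal) := by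
  have hm : (0 : ℝ) < m := by exact_mod_cast (Nat.zero_le i).trans_lt hi
  have hsub : Set.Ico ((i : ℝ) / m) (((i : ℝ) + 1) / m) ⊆ Set.Icc 0 1 := by
    intro t ht
    refine ⟨le_trans (by positivity) ht.1, ht.2.le.trans ?_⟩
    rw [div_le_one hm]
    exact_mod_cast hi
  have hμ : (volume.restrict (Set.Icc (0 : ℝ) 1)) (Set.Ico ((i : ℝ) / m) (((i : ℝ) + 1) / m)) =
      ENNReal.ofReal (1 / m) := by
    rw [Measure.restrict_apply measurableSet_Ico, Set.inter_eq_left.2 hsub, Real.volume_Ico]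
    congr 1
    ring
  have hpos : 0 < 1 / (m : ℝ) := by positivity
  rw [stepIndicator, norm_indicatorConstLp' hq (by
    rw [hμ]
    exact (ENNReal.ofReal_pos.2 hpos).ne'), norm_one, one_mul,
    Measure.real, hμ, ENNReal.toReal_ofReal hpos.le]

theorem norm_sum_boolSign_stepIndicator_le (q : ℝ≥0∞) [Fact (1 ≤ q)] (m : ℕ)
    (ε : Fin m → Bool) : ‖∑ i, boolSign (ε i) • stepIndicator q m i‖ ≤ 1 := by
  have hae : ∀ᵐ t ∂(volume.restrict (Set.Icc (0 : ℝ) 1)),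
      ‖(∑ i, boolSign (ε i) • stepIndicator q m i : LebesgueSpace q) t‖ ≤ 1 := by
    have h1 : ∀ᵐ t ∂(volume.restrict (Set.Icc (0 : ℝ) 1)), ∀ i : Fin m,
        stepIndicator q m i t = (Set.Ico ((i : ℝ) / m) (((i : ℝ) + 1) / m)).indicator 1 t :=
      ae_all_iff.2 fun i => indicatorConstLp_coeFn
    filter_upwards [coeFn_sum_boolSign_smul (fun i : Fin m => stepIndicator q m i) ε, h1]
      with t ht1 ht2
    rw [ht1]
    simp only [ht2]
    by_cases hex : ∃ j : Fin m, t ∈ Set.Ico ((j : ℝ) / m) (((j : ℝ) + 1) / m)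
    · obtain ⟨j, hj⟩ := hex
      have hm : (0 : ℝ) < m := by exact_mod_cast (Nat.zero_le _).trans_lt j.2
      rw [Finset.sum_eq_single j (fun i _ hij => ?_) (by simp), Set.indicator_of_mem hj]
      · simp [abs_boolSign]
      · rw [Set.indicator_of_notMem, mul_zero]
        intro hi
        refine hij (Fin.ext ?_)
        simp only [Set.mem_Ico, div_le_iff₀ hm, lt_div_iff₀ hm] at hi hj
        have h2 : ((i : ℕ) : ℝ) < (j : ℕ) + 1 := hi.1.trans_lt hj.2
        have h3 : ((j : ℕ) : ℝ) < (i : ℕ) + 1 := hj.1.trans_lt hi.2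
        norm_cast at h2 h3
        omega
    · push Not at hex
      rw [Finset.sum_eq_zero fun i _ => by rw [Set.indicator_of_notMem (hex i), mul_zero]]
      simp
  refine (Lp.norm_le_of_ae_bound zero_le_one hae).trans_eq ?_
  simp [measureUnivNNReal]

/-- A linear embedding of the step functions of `L_q[0,1]` into a bidual of an `L_1` space forces
`q ≤ 2`. -/
theorem not_linearlyEmbeds_bidual_L1 {q : ℝ≥0∞} [Fact (1 ≤ q)] (hq : 2 < q)
    {α : Type*} [MeasurableSpace α] {μ : Measure α} (V : Submodule ℝ (LebesgueSpace q))
    (hV : ∀ m i, stepIndicator q m i ∈ V) :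
    ¬ LinearlyEmbeds V (StrongDual ℝ (StrongDual ℝ (Lp ℝ 1 μ))) := by
  rintro ⟨T, c, hc, hT⟩
  set r : ℝ := 1 / q.toReal with hr
  have hr2 : r < 1 / 2 := by
    -- For `q = ∞`, `toReal` and division by zero give `r = 0`, which is the correct exponent.
    rcases eq_or_ne q ∞ with rfl | hq'
    · simp [hr]
    · have : (2 : ℝ) < q.toReal := by
        simpa using (ENNReal.toReal_lt_toReal (by simp) hq').2 hq
      exact one_div_lt_one_div_of_lt two_pos this
  have key (m : ℕ) (hm : 0 < m) : c * (m : ℝ) ^ (1 / 2 - r) ≤ 2 * ‖T‖ := by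
    have hm' : (0 : ℝ) < m := by exact_mod_cast hm
    let x : Fin m → V := fun i => ⟨stepIndicator q m i, hV m i⟩
    have hx (i : Fin m) : ‖x i‖ = (m : ℝ) ^ (-r) := by
      rw [Real.rpow_neg hm'.le, ← Real.inv_rpow hm'.le, ← one_div]
      exact norm_stepIndicator (zero_lt_two.trans hq).ne' i.2
    have hsum (ε : Fin m → Bool) : ‖∑ i, boolSign (ε i) • T (x i)‖ ≤ ‖T‖ := by
      have h1 : ∑ i, boolSign (ε i) • T (x i) = T (∑ i, boolSign (ε i) • x i) := by simp
      have h2 : ‖∑ i, boolSign (ε i) • x i‖ ≤ 1 := by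
        rw [← Submodule.norm_coe]
        simpa [x] using norm_sum_boolSign_stepIndicator_le q m ε
      rw [h1]
      exact (T.le_of_opNorm_le_of_le le_rfl h2).trans_eq (mul_one _)
    have h1 := sum_norm_le_sum_norm_boolSign_bidual (by positivity)
      (fun x => sum_norm_le_sum_norm_boolSign_L1 (μ := μ) x) fun i => T (x i)
    have h2 : (m : ℝ) * (c * (m : ℝ) ^ (-r)) ≤ ∑ i, ‖T (x i)‖ := by
      refine le_trans (le_of_eq ?_) (Finset.sum_le_sum fun i _ => hT (x i))
      simp [hx]
    have h3 : ∑ ε : Fin m → Bool, ‖∑ i, boolSign (ε i) • T (x i)‖ ≤ 2 ^ m * ‖T‖ := by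
      refine (Finset.sum_le_sum fun ε _ => hsum ε).trans_eq ?_
      simp
    have h4 : (m : ℝ) * (c * (m : ℝ) ^ (-r)) ≤ 2 * √m * ‖T‖ := by
      refine h2.trans (h1.trans ((mul_le_mul_of_nonneg_left h3 (by positivity)).trans_eq ?_))
      field_simp
    have h5 : (m : ℝ) * (c * (m : ℝ) ^ (-r)) = √m * (c * (m : ℝ) ^ (1 / 2 - r)) := by
      rw [sub_eq_add_neg, Real.rpow_add hm', ← Real.sqrt_eq_rpow]
      calc (m : ℝ) * (c * (m : ℝ) ^ (-r)) = (√m * √m) * (c * (m : ℝ) ^ (-r)) := by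
            rw [Real.mul_self_sqrt hm'.le]
        _ = _ := by ring
    rw [h5] at h4
    have hs : 0 < √(m : ℝ) := Real.sqrt_pos.2 hm'
    refine le_of_mul_le_mul_left (h4.trans_eq ?_) hs
    ring
  have hlim : Tendsto (fun m : ℕ => c * (m : ℝ) ^ (1 / 2 - r)) atTop atTop :=
    ((tendsto_rpow_atTop (sub_pos.2 hr2)).comp tendsto_natCast_atTop_atTop).const_mul_atTop hc
  obtain ⟨m, hm1, hm2⟩ := ((hlim.eventually_gt_atTop (2 * ‖T‖)).and (eventually_gt_atTop 0)).exists
  exact hm1.not_ge (key m hm2)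

theorem not_lipschitzEmbeds_L1 {q : ℝ≥0∞} [Fact (1 ≤ q)] (hq : 2 < q) :
    ¬ LipschitzEmbeds (LebesgueSpace q) (LebesgueSpace 1) := by
  rintro ⟨f, ⟨K, hK⟩, L, hL⟩
  let s : Set (LebesgueSpace q) := Set.range fun k : ℕ × ℕ => stepIndicator q k.1 k.2
  -- `L_∞` is not separable, so the embedding is restricted to the closed span of the step
  -- functions, which is separable and complete.
  let V : Submodule ℝ (LebesgueSpace q) := (Submodule.span ℝ s).topologicalClosure
  have hsep : TopologicalSpace.IsSeparable (V : Set (LebesgueSpace q)) := by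
    rw [Submodule.topologicalClosure_coe]
    exact (Set.countable_range _).isSeparable.span.closure
  have : TopologicalSpace.SeparableSpace V := hsep.separableSpace
  have hV : ∀ m i, stepIndicator q m i ∈ V := fun m i =>
    Submodule.le_topologicalClosure _ (Submodule.subset_span ⟨(m, i), rfl⟩)
  have hi : Isometry ((↑) : V → LebesgueSpace q) := isometry_subtype_coe
  exact not_linearlyEmbeds_bidual_L1 hq V hV (linearlyEmbeds_bidual_of_lipschitzEmbeds V _
    ⟨_, ⟨_, hK.comp hi.lipschitz⟩, _, hL.comp hi.antilipschitz⟩)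

theorem corollary2p3 :
    (∀ (X : Type*) [NormedAddCommGroup X] [NormedSpace ℝ X] [CompleteSpace X]
        [TopologicalSpace.SeparableSpace X]
        (F : Type*) [NormedAddCommGroup F] [NormedSpace ℝ F] [CompleteSpace F],
        LipschitzEmbeds X (StrongDual ℝ F) → LinearlyEmbeds X (StrongDual ℝ F)) ∧
    (∀ (X : Type*) [NormedAddCommGroup X] [NormedSpace ℝ X] [CompleteSpace X]
        [TopologicalSpace.SeparableSpace X]
        (Y : Type*) [NormedAddCommGroup Y] [NormedSpace ℝ Y] [CompleteSpace Y],
        LipschitzEmbeds X Y → LinearlyEmbeds X (StrongDual ℝ (StrongDual ℝ Y))) ∧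
    (∀ (q : ℝ≥0∞) [Fact (1 ≤ q)], 2 < q →
        ¬ LipschitzEmbeds (LebesgueSpace q) (LebesgueSpace 1)) :=
  ⟨fun X _ _ _ _ F _ _ _ h => linearlyEmbeds_dual_of_lipschitzEmbeds X F h,
    fun X _ _ _ _ Y _ _ _ h => linearlyEmbeds_bidual_of_lipschitzEmbeds X Y h,
    fun _ _ hq => not_lipschitzEmbeds_L1 hq⟩
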